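/- **Conventions.** A Krull domain is an integral domain $A$ with field of fractions $K$ for which there is a (possibly empty) family of discrete valuation rings of $K$ whose intersection in $K$ is $A$ and such that every nonzero element of $K$ is a unit in all but finitely many members of the family; in particular, fields are Krull domains. A scheme is locally Krull if it has an affine open covering by spectra of Krull domains. For a subset $\Gamma$ of a scheme $Y$, $\operatorname{codim}_Y\Gamma=\inf_{\gamma\in\Gamma}\dim\mathcal O_{Y,\gamma}$, which is $\infty$ if $\Gamma=\emptyset$. **Lemma.** Let $S$ be a scheme, $G$ a flat $S$-group scheme, and $X$ a quasi-compact quasi-separated locally Krull scheme over $S$ with a left action $a\colon G\times_S X\to X$ of $G$. Let $Y$ be an $S$-scheme and let $\varphi\colon X\to Y$ be a $G$-invariant morphism, that is, an $S$-morphism with $\varphi\circ a=\varphi\circ p_2$, where $p_2\colon G\times_S X\to X$ is the second projection. Let $(\varphi_*\mathcal O_X)^G\subseteq\varphi_*\mathcal O_X$ be the subsheaf whose sections over an open set $V\subseteq Y$ are the $f\in\Gamma(\varphi^{-1}(V),\mathcal O_X)$ with $a^*f=p_2^*f$, and assume that the canonical map $\mathcal O_Y\to(\varphi_*\mathcal O_X)^G$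 is an isomorphism. Then: 1. $Y$ is a locally Krull scheme. 2. Each irreducible component of $X$ is mapped dominatingly to an irreducible component of $Y$; that is, for each irreducible component $Z$ of $X$, the closure of $\varphi(Z)$ is an irreducible component of $Y$. 3. $Y$ has only finitely many irreducible components. 4. There exists a quasi-compact open subset $U$ of $Y$ such that $\operatorname{codim}_Y(Y\setminus U)\ge 2$. -/

import Mathlib

open CategoryTheory AlgebraicGeometry MonoidalCategory CartesianMonoidalCategory
open scoped MonObj ModObj

universe u

/-- A Krull domain: an integral domain `R` which, inside its field of fractions `K`, is the
intersection of a (possibly empty) family of discrete valuation rings of `K` such that every nonzero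
element of `K` is a unit in all but finitely many members of the family. Fields are Krull domains
(empty family). -/
class IsKrullDomain (R : Type u) [CommRing R] : Prop extends IsDomain R where
  exists_family : ∃ F : Set (ValuationSubring (FractionRing R)),
    (∀ V ∈ F, IsDiscreteValuationRing V) ∧
    (∀ x : FractionRing R, x ∈ (algebraMap R (FractionRing R)).range ↔ ∀ V ∈ F, x ∈ V) ∧
    (∀ x : FractionRing R, x ≠ 0 → {V ∈ F | V.valuation x ≠ 1}.Finite)

/-- A scheme is locally Krull if it has a covering by affine open subschemes `Spec A`
with `A` a Krull domain. -/
class IsLocallyKrull (X : Scheme.{u}) : Prop where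
  exists_isAffineOpen : ∀ x : X, ∃ U : X.Opens, x ∈ U ∧ IsAffineOpen U ∧ IsKrullDomain Γ(X, U)

/-- The codimension of a subset `T` of a scheme `X`: the infimum of the dimensions of the local
rings `𝒪_{X,x}` for `x ∈ T`. The codimension of the empty set is `⊤`. -/
noncomputable def schemeCodim (X : Scheme.{u}) (T : Set X) : WithBot ℕ∞ :=
  ⨅ x ∈ T, ringKrullDim (X.presheaf.stalk x)

section Invariants

variable {S : Scheme.{u}} (G : Over S) [GrpObj G] {X Y : Over S} [ModObj G X]

/-- The action morphism `a : G ×_S X ⟶ X` of a `G`-scheme `X`. -/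
noncomputable abbrev actionMap (X : Over S) [ModObj G X] : G ⊗ X ⟶ X := γ[G, X]

/-- An `S`-morphism `φ : X ⟶ Y` from a `G`-scheme `X` is `G`-invariant if `φ (g x) = φ x`, that is,
if it is a `G`-morphism for the trivial action of `G` on `Y`. -/
def IsGInvariant (φ : X ⟶ Y) : Prop :=
  actionMap G X ≫ φ = snd G X ≫ φ

variable {G}

theorem IsGInvariant.preimage_le {φ : X ⟶ Y} (hφ : IsGInvariant G φ) (V : Y.left.Opens) :
    (snd G X ≫ φ).left ⁻¹ᵁ V ≤ (actionMap G X).left ⁻¹ᵁ (φ.left ⁻¹ᵁ V) := by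
  have h : (actionMap G X ≫ φ).left ⁻¹ᵁ V = (snd G X ≫ φ).left ⁻¹ᵁ V := by
    rw [show actionMap G X ≫ φ = snd G X ≫ φ from hφ]
  exact h.ge

/-- The sections over `V` of `(φ_* 𝒪_X)^G`: the functions `f` on `φ⁻¹(V)` with `f (g x) = f x`, that
is, whose pullbacks to `G ×_S φ⁻¹(V)` along the action and along the second projection agree. -/
noncomputable def pushforwardInvariants {φ : X ⟶ Y} (hφ : IsGInvariant G φ) (V : Y.left.Opens) :
    Subring Γ(X.left, φ.left ⁻¹ᵁ V) :=
  RingHom.eqLocus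
    ((actionMap G X).left.appLE (φ.left ⁻¹ᵁ V) ((snd G X ≫ φ).left ⁻¹ᵁ V)
      (hφ.preimage_le V)).hom
    ((snd G X).left.appLE (φ.left ⁻¹ᵁ V) ((snd G X ≫ φ).left ⁻¹ᵁ V) le_rfl).hom

theorem app_mem_pushforwardInvariants {φ : X ⟶ Y} (hφ : IsGInvariant G φ) (V : Y.left.Opens)
    (f : Γ(Y.left, V)) : (φ.left.app V).hom f ∈ pushforwardInvariants hφ V := by
  have key : ∀ (a b : G ⊗ X ⟶ X) (_ : a ≫ φ = b ≫ φ)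
      (e : (b ≫ φ).left ⁻¹ᵁ V ≤ a.left ⁻¹ᵁ (φ.left ⁻¹ᵁ V)),
      φ.left.app V ≫ a.left.appLE (φ.left ⁻¹ᵁ V) ((b ≫ φ).left ⁻¹ᵁ V) e =
        φ.left.app V ≫ b.left.appLE (φ.left ⁻¹ᵁ V) ((b ≫ φ).left ⁻¹ᵁ V) le_rfl := by
    intro a b hab e
    have hab' : a.left ≫ φ.left = b.left ≫ φ.left := by
      rw [← Over.comp_left, ← Over.comp_left, hab]
    have h1 : ∀ (c : (G ⊗ X).left ⟶ X.left) (e : (b ≫ φ).left ⁻¹ᵁ V ≤ c ⁻¹ᵁ (φ.left ⁻¹ᵁ V)),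
        φ.left.app V ≫ c.appLE (φ.left ⁻¹ᵁ V) ((b ≫ φ).left ⁻¹ᵁ V) e =
          (c ≫ φ.left).appLE V ((b ≫ φ).left ⁻¹ᵁ V) e := by
      intro c e
      rw [Scheme.Hom.app_eq_appLE, Scheme.Hom.appLE_comp_appLE]
    refine (h1 _ e).trans (Eq.trans ?_ (h1 _ le_rfl).symm)
    congr 1
  exact congrArg (fun r => r.hom f) (key (actionMap G X) (snd G X) hφ (hφ.preimage_le V))

/-- The canonical map `𝒪_Y ⟶ (φ_* 𝒪_X)^G` on sections over `V`. -/
noncomputable def toPushforwardInvariants {φ : X ⟶ Y} (hφ : IsGInvariant G φ) (V : Y.left.Opens) :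
    Γ(Y.left, V) →+* pushforwardInvariants hφ V :=
  (φ.left.app V).hom.codRestrict _ (app_mem_pushforwardInvariants hφ V)

end Invariants

/-!
The action `a` and the second projection `p` of `G ×_S X` are both flat, since they differ by the
automorphism `(g, x) ↦ (g, g x)` (`flat_actionMap_left`). Hence they are injective on local rings,
and a nonzero element of a local domain of `X` remains a nonzerodivisor on `G ×_S X`. The rest of
the argument only uses a pair of flat morphisms `a, p : Z ⟶ X` and a morphism `φ : X ⟶ Y` such that
the functions on `Y` are the functions on `X` equalized by `a` and `p` (`IsFlatQuotient`). There are
two consequences.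

* If `s` and `t` are invariant, `t` has nonzero germs and `s / t` is regular on `X`, then `s / t` is
  invariant (`IsFlatQuotient.dvd_of_app_dvd`).
* The locus in `X` where an invariant function has nonzero germ is open and closed, and its
  indicator function is invariant (`IsFlatQuotient.exists_germ_indicator`).

As `X` is covered by finitely many spectra of domains, the second fact gives each point of `Y` an
affine neighbourhood `V` such that every nonzero function on `V` has only nonzero germs on `φ⁻¹(V)`
(`IsFlatQuotient.exists_hasNonzeroGerms`). In particular `Γ(Y, V)` is a domain. The discrete
valuation rings defining the charts of `X` and centred in `φ⁻¹(V)` detect divisibility in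
`Γ(X, φ⁻¹(V))`, and by the first fact also in `Γ(Y, V)`; so `Γ(Y, V)` is a Krull domain, defined by
their intersections with its field of fractions (`HasNonzeroGerms.isKrullDomain`). The preimage
`φ⁻¹(V)` need not be quasi-compact here.

At the generic point of a component of `X` every nonzero germ is a unit, so this point is mapped to
the generic point of `V`. This gives the statements on irreducible components.

Finally, a point of `Y` of codimension at most one lies in the image of `φ`: a height one prime of a
Krull domain is the centre of a member of any defining family
(`IsFlatQuotient.two_le_ringKrullDim_stalk`). As `φ(X)` is quasi-compact, it is contained in a
quasi-compact open subset of `Y`.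
-/

/-! ### Discrete valuation rings and Krull domains -/

/-- A domain which is not a field and maps to a discrete valuation ring by a ring homomorphism
reflecting divisibility is itself a discrete valuation ring. This applies to the intersection of a
discrete valuation ring with a subfield of its field of fractions. -/
theorem IsDiscreteValuationRing.of_reflects_dvd {B O : Type*} [CommRing B] [IsDomain B]
    [CommRing O] [IsDomain O] [IsDiscreteValuationRing O] (j : B →+* O)
    (hj : ∀ x y, j x ∣ j y → x ∣ y) (hB : ¬ IsField B) : IsDiscreteValuationRing B := by
  have hinj : ∀ x, j x = 0 → x = 0 := fun x hx => by
    have := hj 0 x (by simp [hx])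
    simpa using this
  have hu : ∀ x, IsUnit (j x) → IsUnit x := fun x hx =>
    isUnit_of_dvd_one (hj x 1 (by rw [map_one]; exact hx.dvd))
  have : ValuationRing B := ValuationRing.iff_dvd_total.2 ⟨fun x y =>
    ((ValuationRing.dvd_total (j x) (j y)).imp (hj _ _) (hj _ _))⟩
  have : WfDvdMonoid B := ⟨by
    refine Subrelation.wf (r := InvImage DvdNotUnit j) ?_
      (InvImage.wf j (wellFounded_dvdNotUnit))
    rintro x y ⟨hx, z, hz, rfl⟩
    exact ⟨fun h => hx (hinj _ h), j z, fun h => hz (hu _ h), by rw [map_mul]⟩⟩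
  have : IsPrincipalIdealRing B := ((IsBezout.TFAE (R := B)).out 3 1).1 this
  exact { not_a_field' := fun h => hB (IsLocalRing.isField_iff_maximalIdeal_eq.2 h) }

theorem IsDiscreteValuationRing.exists_dvd_pow {O : Type*} [CommRing O] [IsDomain O]
    [IsDiscreteValuationRing O] {q a : O} (hq : q ≠ 0) (ha : ¬ IsUnit a) : ∃ n, q ∣ a ^ n := by
  obtain ⟨p, hp⟩ := IsDiscreteValuationRing.exists_irreducible O
  obtain ⟨n, hn⟩ := IsDiscreteValuationRing.associated_pow_irreducible hq hp
  have : p ∣ a := by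
    have h1 : a ∈ IsLocalRing.maximalIdeal O := ha
    rw [hp.maximalIdeal_eq, Ideal.mem_span_singleton] at h1
    exact h1
  exact ⟨n, hn.dvd.trans (pow_dvd_pow_of_dvd this n)⟩

/-- For a defining family `F` of a Krull domain `R` and `f : R`, the localization `R[1/f]` is the
intersection of the members of `F` in which `f` is a unit. -/
theorem exists_algebraMap_eq_pow_mul {R : Type u} [CommRing R] [IsDomain R]
    {F : Set (ValuationSubring (FractionRing R))}
    (hdvr : ∀ V ∈ F, IsDiscreteValuationRing V)
    (hmem : ∀ x : FractionRing R, x ∈ (algebraMap R (FractionRing R)).range ↔ ∀ V ∈ F, x ∈ V)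
    (hfin : ∀ x : FractionRing R, x ≠ 0 → {V ∈ F | V.valuation x ≠ 1}.Finite)
    (f : R) (c : FractionRing R)
    (hc : ∀ V ∈ F, V.valuation (algebraMap R (FractionRing R) f) = 1 → c ∈ V) :
    ∃ (n : ℕ) (r : R), algebraMap R (FractionRing R) r =
      algebraMap R (FractionRing R) f ^ n * c := by
  rcases eq_or_ne c 0 with rfl | hc0
  · exact ⟨0, 0, by simp⟩
  set φ := algebraMap R (FractionRing R)
  have hfV : ∀ V ∈ F, φ f ∈ V := (hmem (φ f)).1 ⟨f, rfl⟩
  have key : ∀ V ∈ F, ∃ n : ℕ, φ f ^ n * c ∈ V := by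
    intro V hV
    by_cases h : V.valuation (φ f) = 1
    · exact ⟨0, by simpa using hc V hV h⟩
    have := hdvr V hV
    obtain ⟨p, q, hq, rfl⟩ := IsFractionRing.div_surjective (A := V) c
    obtain ⟨n, d, hd⟩ := IsDiscreteValuationRing.exists_dvd_pow (a := (⟨φ f, hfV V hV⟩ : V))
      (nonZeroDivisors.ne_zero hq) (fun hu => h ((V.valuation_eq_one_iff ⟨φ f, hfV V hV⟩).1 hu))
    refine ⟨n, ?_⟩
    have h2 : φ f ^ n = algebraMap V _ q * algebraMap V _ d := by
      rw [← map_mul, ← hd]; simp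
    have hq0 : algebraMap V (FractionRing R) q ≠ 0 := by
      simpa using nonZeroDivisors.ne_zero hq
    have h3 : φ f ^ n * (algebraMap V _ p / algebraMap V _ q) = ((d * p : V) : FractionRing R) := by
      rw [h2, ← ValuationSubring.algebraMap_apply, map_mul]
      field_simp
    rw [h3]
    exact (d * p).2
  choose! n hn using key
  refine ⟨(hfin c hc0).toFinset.sup n, ?_⟩
  have : φ f ^ (hfin c hc0).toFinset.sup n * c ∈ φ.range := by
    rw [hmem]
    intro V hV
    by_cases h : V.valuation c = 1
    · exact mul_mem (pow_mem (hfV V hV) _) ((V.valuation_le_one_iff c).1 h.le)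
    · have hle : n V ≤ (hfin c hc0).toFinset.sup n :=
        Finset.le_sup (f := n) (by simpa using ⟨hV, h⟩)
      rw [← Nat.sub_add_cancel hle, pow_add, mul_assoc]
      exact mul_mem (pow_mem (hfV V hV) _) (hn V hV)
  obtain ⟨r, hr⟩ := this
  exact ⟨r, hr⟩

/-- A domain is a Krull domain if it embeds in a family of discrete valuation rings with finite
character that jointly detect divisibility. The defining family consists of the preimages in the
field of fractions of the given valuation rings, those preimages that are the whole field being
discarded. -/
theorem IsKrullDomain.of_discreteValuationRings {A : Type u} [CommRing A] [IsDomain A]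
    {Λ : Type*} (O : Λ → Type*) [∀ l, CommRing (O l)] [∀ l, IsDomain (O l)]
    [∀ l, IsDiscreteValuationRing (O l)] (j : ∀ l, A →+* O l)
    (hinj : ∀ l, Function.Injective (j l))
    (hdvd : ∀ t s, t ≠ 0 → (∀ l, j l t ∣ j l s) → t ∣ s)
    (hfin : ∀ t, t ≠ 0 → {l | ¬ IsUnit (j l t)}.Finite) : IsKrullDomain A := by
  let K := FractionRing A
  let L (l : Λ) := FractionRing (O l)
  let k (l : Λ) : K →+* L l := IsFractionRing.lift (g := (algebraMap (O l) (L l)).comp (j l))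
    ((IsFractionRing.injective (O l) (L l)).comp (hinj l))
  have hk : ∀ l a, k l (algebraMap A K a) = algebraMap (O l) (L l) (j l a) := fun l a =>
    IsFractionRing.lift_algebraMap _ a
  let V (l : Λ) : ValuationSubring K :=
    (ValuationRing.valuation (O l) (L l)).valuationSubring.comap (k l)
  have hV : ∀ l c, c ∈ V l ↔ ∃ b, algebraMap (O l) (L l) b = k l c := fun l c =>
    ValuationRing.mem_integer_iff (O l) (L l) (k l c)
  have hVdiv : ∀ l s t, t ≠ 0 → (algebraMap A K s / algebraMap A K t ∈ V l ↔ j l t ∣ j l s) := by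
    intro l s t ht
    have ht' : algebraMap (O l) (L l) (j l t) ≠ 0 := by
      simpa using fun h => ht ((map_eq_zero_iff _ (hinj l)).1 h)
    rw [hV, map_div₀, hk, hk]
    constructor
    · rintro ⟨b, hb⟩
      rw [eq_div_iff ht', ← map_mul] at hb
      exact ⟨b, by rw [← IsFractionRing.injective (O l) (L l) hb, mul_comm]⟩
    · rintro ⟨b, hb⟩
      exact ⟨b, by rw [eq_div_iff ht', ← map_mul, hb, mul_comm]⟩
  have hjV : ∀ l a, algebraMap A K a ∈ V l := fun l a => (hV _ _).2 ⟨_, (hk _ _).symm⟩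
  have hunit : ∀ l a, IsUnit (j l a) → (V l).valuation (algebraMap A K a) = 1 := by
    intro l a ha
    have ha0 : a ≠ 0 := by rintro rfl; simp at ha
    have h1 : algebraMap A K 1 / algebraMap A K a ∈ V l := (hVdiv l 1 a ha0).2 ha.dvd
    refine ((V l).valuation_eq_one_iff ⟨_, hjV l a⟩).1 (IsUnit.of_mul_eq_one ⟨_, h1⟩ ?_)
    ext
    have : algebraMap A K a ≠ 0 := by simpa using ha0
    simp [this]
  refine ⟨⟨{W | ∃ l, W = V l ∧ V l ≠ ⊤}, ?_, ?_, ?_⟩⟩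
  · rintro _ ⟨l, rfl, htop⟩
    let e := ValuationRing.equivInteger (O l) (L l)
    let r : V l →+* (ValuationRing.valuation (O l) (L l)).integer :=
      (k l).restrict (V l) _ (fun x hx => hx)
    refine IsDiscreteValuationRing.of_reflects_dvd (e.symm.toRingHom.comp r) ?_ ?_
    · rintro x y ⟨z, hz⟩
      have h1 : r y = r x * e z := e.symm.injective (by simpa using hz)
      have h2 : k l y = k l x * algebraMap (O l) (L l) z := congrArg Subtype.val h1
      by_cases hx : (x : K) = 0
      · have : (y : K) = 0 := by rw [hx, map_zero, zero_mul, map_eq_zero] at h2; exact h2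
        have hx' : x = 0 := Subtype.ext hx
        have hy' : y = 0 := Subtype.ext this
        rw [hx', hy']
      · refine ⟨⟨(y : K) / x, (hV _ _).2 ⟨z, ?_⟩⟩, ?_⟩
        · have : k l x ≠ 0 := by simpa using hx
          rw [map_div₀, eq_div_iff this, h2, mul_comm]
        · ext
          simp [mul_div_cancel₀, hx]
    · intro hf
      apply htop
      rw [ValuationSubring.eq_top_iff, Valuation.isNontrivial_iff_exists_lt_one]
      rintro ⟨x, hx0, hx⟩
      have hxV : x ∈ V l := (ValuationSubring.valuation_le_one_iff _ x).1 hx.le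
      obtain ⟨y, hy⟩ := hf.mul_inv_cancel (a := ⟨x, hxV⟩) (fun h => hx0 (congrArg Subtype.val h))
      exact hx.ne (((V l).valuation_eq_one_iff ⟨x, hxV⟩).1 (IsUnit.of_mul_eq_one _ hy))
  · intro x
    constructor
    · rintro ⟨a, rfl⟩ _ ⟨l, rfl, -⟩
      exact hjV l a
    · intro h
      obtain ⟨s, t, ht, rfl⟩ := IsFractionRing.div_surjective (A := A) x
      have ht0 := nonZeroDivisors.ne_zero ht
      obtain ⟨b, rfl⟩ := hdvd t s ht0 (fun l => (hVdiv l s t ht0).1 (by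
        by_cases hl : V l = ⊤
        · rw [hl]; trivial
        · exact h _ ⟨l, rfl, hl⟩))
      have : algebraMap A K t ≠ 0 := by simpa using ht0
      exact ⟨b, by rw [map_mul, mul_div_cancel_left₀ _ this]⟩
  · intro x hx
    obtain ⟨s, t, ht, rfl⟩ := IsFractionRing.div_surjective (A := A) x
    have ht0 := nonZeroDivisors.ne_zero ht
    have hs0 : s ≠ 0 := by rintro rfl; simp at hx
    refine (((hfin s hs0).union (hfin t ht0)).image V).subset ?_
    rintro _ ⟨⟨l, rfl, -⟩, hv⟩
    refine ⟨l, ?_, rfl⟩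
    by_contra hcon
    simp only [Set.mem_union, Set.mem_ofPred_eq, not_or, not_not] at hcon
    exact hv (by rw [map_div₀, hunit l s hcon.1, hunit l t hcon.2, div_one])

/-! ### Germs of sections on spectra of domains -/

namespace AlgebraicGeometry

variable {X : Scheme.{u}}

theorem Scheme.section_ext_germ {W : X.Opens} {s t : Γ(X, W)}
    (h : ∀ x (hx : x ∈ W), X.presheaf.germ W x hx s = X.presheaf.germ W x hx t) : s = t :=
  TopCat.Presheaf.section_ext X.sheaf W s t h

theorem IsAffineOpen.germ_injective_of_isDomain {U : X.Opens} (hU : IsAffineOpen U)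
    [IsDomain Γ(X, U)] {x : X} (hx : x ∈ U) :
    Function.Injective (X.presheaf.germ U x hx) := by
  have := hU.isLocalization_stalk ⟨x, hx⟩
  let : Algebra Γ(X, U) (X.presheaf.stalk x) := (X.presheaf.germ U x hx).hom.toAlgebra
  have : IsLocalization.AtPrime (X.presheaf.stalk x) (hU.primeIdealOf ⟨x, hx⟩).asIdeal :=
    hU.isLocalization_stalk ⟨x, hx⟩
  exact IsLocalization.injective (X.presheaf.stalk x)
    (Ideal.primeCompl_le_nonZeroDivisors (hU.primeIdealOf ⟨x, hx⟩).asIdeal)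

theorem IsAffineOpen.isDomain_stalk {U : X.Opens} (hU : IsAffineOpen U)
    [IsDomain Γ(X, U)] {x : X} (hx : x ∈ U) : IsDomain (X.presheaf.stalk x) := by
  let : Algebra Γ(X, U) (X.presheaf.stalk x) := (X.presheaf.germ U x hx).hom.toAlgebra
  have : IsLocalization.AtPrime (X.presheaf.stalk x) (hU.primeIdealOf ⟨x, hx⟩).asIdeal :=
    hU.isLocalization_stalk ⟨x, hx⟩
  exact IsLocalization.isDomain_of_le_nonZeroDivisors (X.presheaf.stalk x)
    (Ideal.primeCompl_le_nonZeroDivisors (hU.primeIdealOf ⟨x, hx⟩).asIdeal)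

/-- On a basic open `D(f)` of an affine open `U`, a section is a fraction `r / f ^ n` with `r` a
section on `U`; this is stated on germs. -/
theorem IsAffineOpen.exists_germ_mul_pow_eq {U : X.Opens} (hU : IsAffineOpen U) {W : X.Opens}
    (f : Γ(X, U)) (hf : X.basicOpen f ≤ W) (s : Γ(X, W)) :
    ∃ (n : ℕ) (r : Γ(X, U)), ∀ x (hx : x ∈ X.basicOpen f),
      X.presheaf.germ W x (hf hx) s * X.presheaf.germ U x (X.basicOpen_le f hx) f ^ n =
        X.presheaf.germ U x (X.basicOpen_le f hx) r := by
  have := hU.isLocalization_basicOpen f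
  obtain ⟨n, r, h⟩ := IsLocalization.Away.surj f (X.presheaf.map (homOfLE hf).op s)
  refine ⟨n, r, fun x hx => ?_⟩
  have h2 := congrArg (X.presheaf.germ (X.basicOpen f) x hx) h
  rw [map_mul, map_pow, TopCat.Presheaf.germ_res_apply] at h2
  erw [TopCat.Presheaf.germ_res_apply, TopCat.Presheaf.germ_res_apply] at h2
  exact h2

/-- The germs of a section on the spectrum of a domain are either all zero or all nonzero. -/
theorem IsAffineOpen.germ_eq_zero_of_germ_eq_zero {U : X.Opens} (hU : IsAffineOpen U)
    [IsDomain Γ(X, U)] {W : X.Opens} {s : Γ(X, W)} {x y : X} (hx : x ∈ U) (hxW : x ∈ W)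
    (hy : y ∈ U) (hyW : y ∈ W) (h : X.presheaf.germ W x hxW s = 0) :
    X.presheaf.germ W y hyW s = 0 := by
  obtain ⟨f, hfW, hf⟩ := hU.exists_basicOpen_le ⟨x, hxW⟩ hx
  obtain ⟨g, hgW, hg⟩ := hU.exists_basicOpen_le ⟨y, hyW⟩ hy
  obtain ⟨n, r, hr⟩ := hU.exists_germ_mul_pow_eq f hfW s
  obtain ⟨m, q, hq⟩ := hU.exists_germ_mul_pow_eq g hgW s
  have hr0 : r = 0 := hU.germ_injective_of_isDomain hx (by
    have := hr x hf; rw [h, zero_mul] at this; rw [← this, map_zero])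
  -- the generic point of `U` lies in every nonempty basic open subset of `U`
  have hgen : ∀ (k : Γ(X, U)) (w : X), w ∈ X.basicOpen k →
      hU.fromSpec (⊥ : PrimeSpectrum Γ(X, U)) ∈ X.basicOpen k := by
    intro k w hw
    change (⊥ : PrimeSpectrum Γ(X, U)) ∈ hU.fromSpec ⁻¹ᵁ X.basicOpen k
    rw [hU.fromSpec_preimage_basicOpen]
    rintro (rfl : k = 0)
    simp at hw
  have hz := And.intro (hgen f x hf) (hgen g y hg)
  set z := hU.fromSpec (⊥ : PrimeSpectrum Γ(X, U))
  have := hU.isDomain_stalk (X.basicOpen_le f hz.1)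
  have hs : X.presheaf.germ W z (hfW hz.1) s = 0 := by
    have h1 := hr z hz.1
    rw [hr0, map_zero] at h1
    exact (mul_eq_zero.1 h1).resolve_right (pow_ne_zero _ ((X.mem_basicOpen _ _ _).1 hz.1).ne_zero)
  have hq0 : q = 0 := hU.germ_injective_of_isDomain (X.basicOpen_le g hz.2) (by
    have := hq z hz.2; rw [hs, zero_mul] at this; rw [← this, map_zero])
  have := hU.isDomain_stalk hy
  have h1 := hq y hg
  rw [hq0, map_zero] at h1
  exact (mul_eq_zero.1 h1).resolve_right (pow_ne_zero _ ((X.mem_basicOpen _ _ _).1 hg).ne_zero)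

/-- On a scheme whose stalks are domains, a section with nonzero germs divides every section that it
divides on all stalks: the local quotients are unique, hence glue. -/
theorem Scheme.dvd_of_germ_dvd [∀ x : X, IsDomain (X.presheaf.stalk x)] {W : X.Opens}
    {t s : Γ(X, W)} (ht : ∀ x (hx : x ∈ W), X.presheaf.germ W x hx t ≠ 0)
    (h : ∀ x (hx : x ∈ W), X.presheaf.germ W x hx t ∣ X.presheaf.germ W x hx s) : t ∣ s := by
  have key : ∀ x : W, ∃ (D : X.Opens) (_ : x.1 ∈ D) (i : D ⟶ W) (b : Γ(X, D)),
      X.presheaf.map i.op s = X.presheaf.map i.op t * b := by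
    rintro ⟨x, hx⟩
    obtain ⟨b', hb'⟩ := h x hx
    obtain ⟨V, hxV, b, rfl⟩ := X.presheaf.exists_germ_eq b'
    rw [← X.presheaf.germ_res_apply (TopologicalSpace.Opens.infLELeft W V) x ⟨hx, hxV⟩ s,
      ← X.presheaf.germ_res_apply (TopologicalSpace.Opens.infLELeft W V) x ⟨hx, hxV⟩ t,
      ← X.presheaf.germ_res_apply (TopologicalSpace.Opens.infLERight W V) x ⟨hx, hxV⟩ b,
      ← map_mul] at hb'
    obtain ⟨D, hxD, i₁, i₂, he⟩ := X.presheaf.germ_eq x _ _ _ _ hb'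
    obtain rfl : i₁ = i₂ := Subsingleton.elim _ _
    refine ⟨D, hxD, i₁ ≫ TopologicalSpace.Opens.infLELeft W V,
      X.presheaf.map (i₁ ≫ TopologicalSpace.Opens.infLERight W V).op b, ?_⟩
    simpa [op_comp, Functor.map_comp] using he
  choose D hD i b hb using key
  have hgerm : ∀ (p : W) (z : X) (hz : z ∈ D p), X.presheaf.germ W z ((i p).le hz) s =
      X.presheaf.germ W z ((i p).le hz) t * X.presheaf.germ (D p) z hz (b p) := by
    intro p z hz
    have := congrArg (X.presheaf.germ (D p) z hz) (hb p)
    rwa [map_mul, X.presheaf.germ_res_apply, X.presheaf.germ_res_apply] at this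
  obtain ⟨(β : Γ(X, W)), hβ, -⟩ := X.sheaf.existsUnique_gluing' D W i
    (fun x hx => TopologicalSpace.Opens.mem_iSup.2 ⟨⟨x, hx⟩, hD _⟩) b (by
      intro p q
      refine X.section_ext_germ fun z hz => ?_
      erw [TopCat.Presheaf.germ_res_apply, TopCat.Presheaf.germ_res_apply]
      have h1 := hgerm p z hz.1
      rw [hgerm q z hz.2] at h1
      exact (mul_left_cancel₀ (ht z _) h1).symm)
  refine ⟨β, X.section_ext_germ fun z hz => ?_⟩
  rw [map_mul, hgerm ⟨z, hz⟩ z (hD _), ← hβ ⟨z, hz⟩]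
  congr 1
  exact X.presheaf.germ_res_apply _ _ _ _

/-- A valuation ring `V` of the field of fractions of `Γ(X, U)` that contains `Γ(X, U)` has a centre
on `U`, and `V` dominates the local ring at the centre. -/
theorem IsAffineOpen.exists_stalk_hom_valuationSubring {U : X.Opens} (hU : IsAffineOpen U)
    [IsDomain Γ(X, U)] {V : ValuationSubring (FractionRing Γ(X, U))}
    (hV : ∀ r, algebraMap Γ(X, U) (FractionRing Γ(X, U)) r ∈ V) :
    ∃ (x : X) (hx : x ∈ U) (j : X.presheaf.stalk x →+* V), Function.Injective j ∧ IsLocalHom j ∧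
      ∀ r, (j (X.presheaf.germ U x hx r) : FractionRing Γ(X, U)) = algebraMap _ _ r := by
  let i : Γ(X, U) →+* V := (algebraMap Γ(X, U) (FractionRing Γ(X, U))).codRestrict V hV
  have hi : Function.Injective i := fun a b h =>
    IsFractionRing.injective Γ(X, U) (FractionRing Γ(X, U)) (congrArg Subtype.val h)
  let p : PrimeSpectrum Γ(X, U) := ⟨(IsLocalRing.maximalIdeal V).comap i, inferInstance⟩
  have hx : hU.fromSpec p ∈ U := by
    have : hU.fromSpec p ∈ Set.range hU.fromSpec := ⟨p, rfl⟩
    rwa [hU.range_fromSpec] at this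
  let : Algebra Γ(X, U) (X.presheaf.stalk (hU.fromSpec p)) :=
    (X.presheaf.germ U _ hx).hom.toAlgebra
  have hloc : IsLocalization.AtPrime (X.presheaf.stalk (hU.fromSpec p)) p.asIdeal :=
    hU.isLocalization_stalk' p hx
  have hunit : ∀ y : p.asIdeal.primeCompl, IsUnit (i y) := fun y => by
    by_contra h
    exact y.2 h
  refine ⟨_, hx, IsLocalization.lift (S := X.presheaf.stalk (hU.fromSpec p)) hunit, ?_, ?_, ?_⟩
  · rw [IsLocalization.lift_injective_iff]
    intro a b
    rw [hi.eq_iff]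
    exact (IsLocalization.injective (X.presheaf.stalk (hU.fromSpec p))
      (Ideal.primeCompl_le_nonZeroDivisors p.asIdeal)).eq_iff
  · refine ⟨fun a ha => ?_⟩
    obtain ⟨r, y, rfl⟩ := IsLocalization.exists_mk'_eq p.asIdeal.primeCompl a
    rw [IsLocalization.AtPrime.isUnit_mk'_iff _ p.asIdeal]
    intro hr
    have h1 : i r = i y * IsLocalization.lift (S := X.presheaf.stalk (hU.fromSpec p)) hunit
        (IsLocalization.mk' _ r y) :=
      (IsLocalization.lift_mk'_spec _ _ _ _).1 rfl
    exact hr (h1 ▸ (hunit y).mul ha)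
  · intro r
    exact congrArg Subtype.val (IsLocalization.lift_eq hunit r)

end AlgebraicGeometry

/-! ### Defining families of locally Krull schemes -/

namespace AlgebraicGeometry

variable {X : Scheme.{u}}

theorem isDomain_stalk_of_isLocallyKrull [IsLocallyKrull X] (x : X) :
    IsDomain (X.presheaf.stalk x) := by
  obtain ⟨U, hx, hU, hK⟩ := IsLocallyKrull.exists_isAffineOpen x
  exact hU.isDomain_stalk hx

/-- A defining family of a locally Krull scheme `X`: discrete valuation rings, each dominating the
local ring of `X` at a point, such that divisibility by a section with nonzero germs can be tested
in these rings, and such that a section with nonzero germs is a unit at almost all of the points.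
The points need not be distinct or of codimension one. -/
structure KrullFamily (X : Scheme.{u}) where
  /-- the index set of the family -/
  idx : Type u
  /-- the centre on `X` of a member of the family -/
  pt : idx → X
  /-- the discrete valuation rings of the family -/
  ring : idx → Type u
  [commRing : ∀ l, CommRing (ring l)]
  [isDomain : ∀ l, IsDomain (ring l)]
  [isDiscreteValuationRing : ∀ l, IsDiscreteValuationRing (ring l)]
  /-- the local ring of `X` at the centre, mapped into the discrete valuation ring -/
  hom : ∀ l, X.presheaf.stalk (pt l) →+* ring l
  hom_injective : ∀ l, Function.Injective (hom l)
  isLocalHom_hom : ∀ l, IsLocalHom (hom l)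
  dvd_of_hom_dvd : ∀ (W : X.Opens) (t s : Γ(X, W)),
    (∀ x (hx : x ∈ W), X.presheaf.germ W x hx t ≠ 0) →
    (∀ l (hl : pt l ∈ W), hom l (X.presheaf.germ W _ hl t) ∣ hom l (X.presheaf.germ W _ hl s)) →
    t ∣ s
  finite_notMem_basicOpen : ∀ (W : X.Opens) (t : Γ(X, W)),
    (∀ x (hx : x ∈ W), X.presheaf.germ W x hx t ≠ 0) →
    {l | pt l ∈ W ∧ pt l ∉ X.basicOpen t}.Finite

attribute [instance] KrullFamily.commRing KrullFamily.isDomain KrullFamily.isDiscreteValuationRing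
  KrullFamily.isLocalHom_hom

/-- The defining family of the Krull domain of sections on an affine open `U`, seen on stalks: it
tests divisibility at the points of `U` and has finite character there. -/
theorem IsAffineOpen.exists_krullFamily {U : X.Opens} (hU : IsAffineOpen U)
    (hK : IsKrullDomain Γ(X, U)) :
    ∃ (F : Set (ValuationSubring (FractionRing Γ(X, U)))) (pt : F → X)
      (hom : ∀ V : F, X.presheaf.stalk (pt V) →+* V.1),
      (∀ V : F, IsDiscreteValuationRing V.1) ∧
      (∀ V, Function.Injective (hom V)) ∧ (∀ V, IsLocalHom (hom V)) ∧
      (∀ (W : X.Opens) (t s : Γ(X, W)),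
        (∀ x (hx : x ∈ W), X.presheaf.germ W x hx t ≠ 0) →
        (∀ V (hV : pt V ∈ W),
          hom V (X.presheaf.germ W _ hV t) ∣ hom V (X.presheaf.germ W _ hV s)) →
        ∀ x (hx : x ∈ W), x ∈ U → X.presheaf.germ W x hx t ∣ X.presheaf.germ W x hx s) ∧
      (∀ (W : X.Opens) (t : Γ(X, W)),
        (∀ x (hx : x ∈ W), X.presheaf.germ W x hx t ≠ 0) →
        {V | pt V ∈ W ∧ pt V ∉ X.basicOpen t}.Finite) := by
  obtain ⟨F, hdvr, hmem, hfin⟩ := hK.exists_family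
  have hRV : ∀ V ∈ F, ∀ r, algebraMap Γ(X, U) (FractionRing Γ(X, U)) r ∈ V := fun V hV r =>
    (hmem _).1 ⟨r, rfl⟩ V hV
  choose pt hpt hom hinj hloc hhom using
    fun V : F => hU.exists_stalk_hom_valuationSubring (hRV V.1 V.2)
  have hunit : ∀ (V : F) (f : Γ(X, U)), V.1.valuation (algebraMap _ _ f) = 1 →
      pt V ∈ X.basicOpen f := by
    intro V f hf
    rw [X.mem_basicOpen _ _ (hpt V)]
    refine (hloc V).map_nonunit _ ?_
    rw [ValuationSubring.valuation_eq_one_iff, hhom, hf]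
  refine ⟨F, pt, hom, fun V => hdvr V.1 V.2, hinj, hloc, ?_, ?_⟩
  · -- near `x`, write `s = r / f ^ n` and `t = q / f ^ m`; it suffices that `r / q` is regular on
    -- `D(f)`, which is tested by the members of `F` with centre in `D(f)`
    intro W t s ht hdvd x hx hxU
    obtain ⟨f, hfW, hf⟩ := hU.exists_basicOpen_le ⟨x, hx⟩ hxU
    obtain ⟨n, r, hr⟩ := hU.exists_germ_mul_pow_eq f hfW s
    obtain ⟨m, q, hq⟩ := hU.exists_germ_mul_pow_eq f hfW t
    have := hU.isDomain_stalk hxU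
    have hfx := (X.mem_basicOpen _ _ hxU).1 hf
    have hq0 : q ≠ 0 := by
      rintro rfl
      have h1 := hq x hf
      rw [map_zero] at h1
      exact mul_ne_zero (ht x hx) (pow_ne_zero _ hfx.ne_zero) h1
    have hq0' : algebraMap Γ(X, U) (FractionRing Γ(X, U)) q ≠ 0 := by simpa using hq0
    obtain ⟨N, a, ha⟩ := exists_algebraMap_eq_pow_mul hdvr hmem hfin f
      (algebraMap _ _ r / algebraMap _ _ q) (by
        intro V hV hVf
        have hpf := hunit ⟨V, hV⟩ f hVf
        have hpu := (X.mem_basicOpen _ _ (hpt ⟨V, hV⟩)).1 hpf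
        have h1 : X.presheaf.germ U _ (hpt ⟨V, hV⟩) q ∣
            X.presheaf.germ W _ (hfW hpf) t :=
          ⟨↑((hpu.pow m).unit)⁻¹, by rw [← hq _ hpf, mul_assoc, IsUnit.mul_val_inv, mul_one]⟩
        have h2 : X.presheaf.germ W _ (hfW hpf) s ∣ X.presheaf.germ U _ (hpt ⟨V, hV⟩) r :=
          ⟨_, (hr _ hpf).symm⟩
        obtain ⟨b, hb⟩ := ((map_dvd (hom ⟨V, hV⟩) h1).trans (hdvd _ (hfW hpf))).trans
          (map_dvd (hom ⟨V, hV⟩) h2)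
        have h3 := congrArg Subtype.val hb
        rw [MulMemClass.coe_mul, hhom, hhom] at h3
        rw [h3, mul_div_cancel_left₀ _ hq0']
        exact b.2)
    have h4 : f ^ N * r = q * a := by
      apply IsFractionRing.injective Γ(X, U) (FractionRing Γ(X, U))
      rw [map_mul, map_mul, map_pow, ha]
      field_simp
    have h5 := congrArg (X.presheaf.germ U x hxU) h4
    rw [map_mul, map_mul, map_pow, ← hr x hf, ← hq x hf] at h5
    refine ((hfx.pow N).mul (hfx.pow n)).dvd_mul_left.1 (Dvd.intro
      (X.presheaf.germ U x hxU f ^ m * X.presheaf.germ U x hxU a) ?_)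
    linear_combination -h5
  · -- if `t = r / f ^ n` on `D(f)`, then `t` is a unit at the centre of each member of `F` in which
    -- both `f` and `r` are units
    intro W t ht
    by_cases hUW : ∃ x, x ∈ U ∧ x ∈ W
    swap
    · convert Set.finite_empty
      ext V
      simp only [Set.mem_ofPred_eq, Set.mem_empty_iff_false, iff_false, not_and]
      exact fun h => (hUW ⟨_, hpt V, h⟩).elim
    obtain ⟨x, hxU, hx⟩ := hUW
    obtain ⟨f, hfW, hf⟩ := hU.exists_basicOpen_le ⟨x, hx⟩ hxU
    obtain ⟨n, r, hr⟩ := hU.exists_germ_mul_pow_eq f hfW t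
    have := hU.isDomain_stalk hxU
    have hfx := (X.mem_basicOpen _ _ hxU).1 hf
    have hr0 : r ≠ 0 := by
      rintro rfl
      have h1 := hr x hf
      rw [map_zero] at h1
      exact mul_ne_zero (ht x hx) (pow_ne_zero _ hfx.ne_zero) h1
    have hf0 : f ≠ 0 := by
      rintro rfl
      simp at hf
    refine (((hfin (algebraMap _ _ f) (by simpa using hf0)).union
      (hfin (algebraMap _ _ r) (by simpa using hr0))).preimage
        (Subtype.val_injective.injOn (s := Set.univ) |>.mono (Set.subset_univ _))).subset ?_
    rintro V ⟨hVW, hVt⟩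
    by_contra hcon
    simp only [Set.mem_preimage, Set.mem_union, Set.mem_ofPred_eq, not_or, not_and, not_not]
      at hcon
    have hpf := hunit V f (hcon.1 V.2)
    have hpr := (X.mem_basicOpen _ _ (hpt V)).1 (hunit V r (hcon.2 V.2))
    rw [← hr _ hpf] at hpr
    exact hVt ((X.mem_basicOpen _ _ hVW).2 (isUnit_of_mul_isUnit_left hpr))

theorem nonempty_krullFamily (X : Scheme.{u}) [CompactSpace X] [IsLocallyKrull X] :
    Nonempty (KrullFamily X) := by
  choose U hxU hU hK using fun x : X => IsLocallyKrull.exists_isAffineOpen x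
  obtain ⟨T, hT⟩ := isCompact_univ.elim_finite_subcover (fun x => (U x : Set X))
    (fun x => (U x).isOpen) (fun x _ => Set.mem_iUnion.2 ⟨x, hxU x⟩)
  choose F pt hom hdvr hinj hloc hdvd hfin using fun x : X => (hU x).exists_krullFamily (hK x)
  have := @isDomain_stalk_of_isLocallyKrull X
  exact ⟨{
    idx := Σ x : T, F x.1
    pt := fun l => pt l.1.1 l.2
    ring := fun l => l.2.1
    isDiscreteValuationRing := fun l => hdvr _ _
    hom := fun l => hom l.1.1 l.2
    hom_injective := fun l => hinj _ _
    isLocalHom_hom := fun l => hloc _ _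
    dvd_of_hom_dvd := by
      intro W t s ht h
      refine Scheme.dvd_of_germ_dvd ht fun x hx => ?_
      obtain ⟨y, hyT, hxy⟩ := Set.mem_iUnion₂.1 (hT (Set.mem_univ x))
      exact hdvd y W t s ht (fun V hV => h ⟨⟨y, hyT⟩, V⟩ hV) x hx hxy
    finite_notMem_basicOpen := by
      intro W t ht
      refine (Set.finite_iUnion fun x : T => (hfin x.1 W t ht).image
        (fun V => (⟨x, V⟩ : Σ x : T, F x.1))).subset ?_
      rintro ⟨x, V⟩ h
      exact Set.mem_iUnion.2 ⟨x, V, h, rfl⟩ }⟩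

end AlgebraicGeometry

/-! ### Flatness of the action and quotients by flat pairs of morphisms -/

/-- The automorphism `(g, x) ↦ (g, g • x)` of `G ⊗ X` defined by an action of a group object. -/
def CategoryTheory.ModObj.shear {C : Type*} [Category* C] [CartesianMonoidalCategory C] (G X : C)
    [GrpObj G] [ModObj G X] : G ⊗ X ≅ G ⊗ X where
  hom := lift (fst G X) (fst G X • snd G X)
  inv := lift (fst G X) ((fst G X)⁻¹ • snd G X)
  hom_inv_id := by
    rw [comp_lift, ModObj.comp_smul, GrpObj.comp_inv]
    simp
  inv_hom_id := by
    rw [comp_lift, ModObj.comp_smul]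
    simp

theorem flat_snd_left {S : Scheme.{u}} (G X : Over S) [Flat G.hom] : Flat (snd G X).left := by
  rw [Over.snd_left]
  infer_instance

/-- The action of a flat group scheme is flat: it is the second projection up to the shear
automorphism. -/
theorem flat_actionMap_left {S : Scheme.{u}} (G X : Over S) [GrpObj G] [Flat G.hom] [ModObj G X] :
    Flat (actionMap G X).left := by
  have h : actionMap G X = (ModObj.shear G X).hom ≫ snd G X := by
    simp [ModObj.shear, Hom.smul_def]
  have := flat_snd_left G X
  have : IsIso (ModObj.shear G X).hom.left :=
    inferInstanceAs (IsIso ((Over.forget S).map (ModObj.shear G X).hom))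
  rw [h, Over.comp_left]
  infer_instance

namespace AlgebraicGeometry

variable {X Y Z : Scheme.{u}}

theorem Flat.stalkMap_injective (f : X ⟶ Y) [Flat f] (x : X) :
    Function.Injective (f.stalkMap x) := by
  have hflat := Flat.stalkMap f x
  algebraize [(f.stalkMap x).hom]
  have : IsLocalHom (algebraMap (Y.presheaf.stalk (f x)) (X.presheaf.stalk x)) :=
    inferInstanceAs (IsLocalHom (f.stalkMap x).hom)
  have := Module.FaithfullyFlat.of_flat_of_isLocalHom (A := Y.presheaf.stalk (f x))
    (B := X.presheaf.stalk x)
  exact FaithfulSMul.algebraMap_injective (Y.presheaf.stalk (f x)) (X.presheaf.stalk x)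

theorem Flat.stalkMap_mul_left_cancel (f : X ⟶ Y) [Flat f] {x : X}
    [IsDomain (Y.presheaf.stalk (f x))] {t : Y.presheaf.stalk (f x)} (ht : t ≠ 0)
    {a b : X.presheaf.stalk x} (h : f.stalkMap x t * a = f.stalkMap x t * b) : a = b := by
  have hflat := Flat.stalkMap f x
  algebraize [(f.stalkMap x).hom]
  refine Module.Flat.isSMulRegular_of_nonZeroDivisors (M := X.presheaf.stalk x)
    (mem_nonZeroDivisors_of_ne_zero ht) ?_
  change t • a = t • b
  rw [Algebra.smul_def, Algebra.smul_def]
  exact h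

/-- `φ : X ⟶ Y` is a quotient of `X` by the pair of flat morphisms `a, p : Z ⟶ X`, on the level of
functions: `φ` coequalizes `a` and `p`, and the functions on `Y` are the functions on `X` that have
the same pullbacks along `a` and `p`. Equality of pullbacks is expressed on stalks. -/
structure IsFlatQuotient (a p : Z ⟶ X) (φ : X ⟶ Y) : Prop where
  flat_left : Flat a
  flat_right : Flat p
  apply_eq : ∀ z, φ (a z) = φ (p z)
  app_injective : ∀ V : Y.Opens, Function.Injective (φ.app V)
  exists_app_eq_iff : ∀ (V : Y.Opens) (b : Γ(X, φ ⁻¹ᵁ V)), (∃ c, φ.app V c = b) ↔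
    ∀ (z : Z) (ha : a z ∈ φ ⁻¹ᵁ V) (hp : p z ∈ φ ⁻¹ᵁ V),
      a.stalkMap z (X.presheaf.germ _ _ ha b) = p.stalkMap z (X.presheaf.germ _ _ hp b)

theorem Scheme.Hom.germ_appLE_apply (f : X ⟶ Y) {U : Y.Opens} {V : X.Opens} (e : V ≤ f ⁻¹ᵁ U)
    {x : X} (hx : x ∈ V) (b : Γ(Y, U)) :
    X.presheaf.germ V x hx (f.appLE U V e b) =
      f.stalkMap x (Y.presheaf.germ U _ (show f x ∈ U from e hx) b) := by
  rw [Scheme.Hom.appLE, CommRingCat.comp_apply]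
  exact (X.presheaf.germ_res_apply _ _ _ _).trans
    (Scheme.Hom.germ_stalkMap_apply f U x (e hx) b).symm

end AlgebraicGeometry

theorem IsGInvariant.isFlatQuotient {S : Scheme.{u}} {G X Y : Over S} [GrpObj G] [Flat G.hom]
    [ModObj G X] {φ : X ⟶ Y} (hφ : IsGInvariant G φ)
    (hiso : ∀ V : Y.left.Opens, Function.Bijective (toPushforwardInvariants hφ V)) :
    IsFlatQuotient (actionMap G X).left (snd G X).left φ.left where
  flat_left := flat_actionMap_left G X
  flat_right := flat_snd_left G X
  apply_eq z := by
    have h : (actionMap G X).left ≫ φ.left = (snd G X).left ≫ φ.left := by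
      rw [← Over.comp_left, ← Over.comp_left]
      exact congrArg _ hφ
    rw [← Scheme.Hom.comp_apply, h, Scheme.Hom.comp_apply]
  app_injective V a b h := (hiso V).1 (Subtype.ext h)
  exists_app_eq_iff V b := by
    have h1 : (∃ c, φ.left.app V c = b) ↔ b ∈ pushforwardInvariants hφ V := by
      constructor
      · rintro ⟨c, rfl⟩
        exact app_mem_pushforwardInvariants hφ V c
      · intro hb
        obtain ⟨c, hc⟩ := (hiso V).2 ⟨b, hb⟩
        exact ⟨c, congrArg Subtype.val hc⟩
    rw [h1]
    -- equality of the pullbacks of `b` along the action and the projection can be tested on stalks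
    constructor
    · intro hb z ha hp
      have hp' : z ∈ (snd G X ≫ φ).left ⁻¹ᵁ V := hp
      have h2 := congrArg ((G ⊗ X).left.presheaf.germ _ z hp') hb
      erw [Scheme.Hom.germ_appLE_apply, Scheme.Hom.germ_appLE_apply] at h2
      exact h2
    · intro h
      refine Scheme.section_ext_germ fun z hz => ?_
      erw [Scheme.Hom.germ_appLE_apply, Scheme.Hom.germ_appLE_apply]
      exact h z (hφ.preimage_le V hz) hz

/-! ### Invariant indicator functions -/

namespace AlgebraicGeometry

variable {X Y Z : Scheme.{u}}

/-- The indicator function of an open and closed part of an open set. -/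
theorem Scheme.exists_germ_eq_one_and_germ_eq_zero {W W₁ W₀ : X.Opens} (h₁ : W₁ ≤ W) (h₀ : W₀ ≤ W)
    (hdisj : Disjoint W₁ W₀) (hcov : W ≤ W₁ ⊔ W₀) :
    ∃ e : Γ(X, W), (∀ x (hx : x ∈ W₁), X.presheaf.germ W x (h₁ hx) e = 1) ∧
      ∀ x (hx : x ∈ W₀), X.presheaf.germ W x (h₀ hx) e = 0 := by
  let U : Bool → X.Opens := fun i => bif i then W₁ else W₀
  let i : ∀ j, U j ⟶ W := fun j => homOfLE (by cases j; exacts [h₀, h₁])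
  let f : ∀ j, Γ(X, U j) := fun j => bif j then 1 else 0
  obtain ⟨(e : Γ(X, W)), he, -⟩ := X.sheaf.existsUnique_gluing' U W i
    (fun x hx => TopologicalSpace.Opens.mem_iSup.2
      ((hcov hx).elim (fun h => ⟨true, h⟩) (fun h => ⟨false, h⟩))) f (by
        intro j k
        by_cases hjk : j = k
        · subst hjk; rfl
        · refine X.section_ext_germ fun z hz => ?_
          have : z ∈ W₁ ⊓ W₀ := by
            cases j <;> cases k
            · exact (hjk rfl).elim
            · exact ⟨hz.2, hz.1⟩
            · exact ⟨hz.1, hz.2⟩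
            · exact (hjk rfl).elim
          rw [hdisj.eq_bot] at this
          exact this.elim)
  refine ⟨e, fun x hx => ?_, fun x hx => ?_⟩
  · have h := congrArg (X.presheaf.germ W₁ x hx) (he true)
    exact (X.presheaf.germ_res_apply (i true) x hx e).symm.trans (h.trans (map_one _))
  · have h := congrArg (X.presheaf.germ W₀ x hx) (he false)
    exact (X.presheaf.germ_res_apply (i false) x hx e).symm.trans (h.trans (map_zero _))

theorem exists_finset_affine_isDomain_cover (X : Scheme.{u}) [CompactSpace X] [IsLocallyKrull X] :
    ∃ T : Finset X.Opens, (∀ U ∈ T, IsAffineOpen U ∧ IsDomain Γ(X, U)) ∧ ∀ x, ∃ U ∈ T, x ∈ U := by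
  classical
  choose U hxU hU hK using fun x : X => IsLocallyKrull.exists_isAffineOpen x
  obtain ⟨T, hT⟩ := isCompact_univ.elim_finite_subcover (fun x => (U x : Set X))
    (fun x => (U x).isOpen) (fun x _ => Set.mem_iUnion.2 ⟨x, hxU x⟩)
  refine ⟨T.image U, fun V hV => ?_, fun x => ?_⟩
  · obtain ⟨y, -, rfl⟩ := Finset.mem_image.1 hV
    exact ⟨hU y, (hK y).toIsDomain⟩
  · obtain ⟨y, hy, hxy⟩ := Set.mem_iUnion₂.1 (hT (Set.mem_univ x))
    exact ⟨U y, Finset.mem_image_of_mem U hy, hxy⟩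

/-- On a locally Krull scheme, the points where the germ of a section vanishes form an open and
closed set, so there is a function with value `1` where the germ is nonzero and `0` elsewhere. -/
theorem Scheme.exists_germ_indicator [IsLocallyKrull X] {W : X.Opens} (s : Γ(X, W)) :
    ∃ e : Γ(X, W), ∀ x (hx : x ∈ W),
      (X.presheaf.germ W x hx s ≠ 0 → X.presheaf.germ W x hx e = 1) ∧
      (X.presheaf.germ W x hx s = 0 → X.presheaf.germ W x hx e = 0) := by
  have hopen : ∀ x (hx : x ∈ W), ∃ U : X.Opens, x ∈ U ∧ U ≤ W ∧ ∀ y (hyU : y ∈ U) (hy : y ∈ W),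
      (X.presheaf.germ W y hy s = 0 ↔ X.presheaf.germ W x hx s = 0) := by
    intro x hx
    obtain ⟨U, hxU, hU, hK⟩ := IsLocallyKrull.exists_isAffineOpen x
    exact ⟨U ⊓ W, ⟨hxU, hx⟩, inf_le_right, fun y hyU hy =>
      ⟨hU.germ_eq_zero_of_germ_eq_zero hyU.1 hy hxU hx,
        hU.germ_eq_zero_of_germ_eq_zero hxU hx hyU.1 hy⟩⟩
  let W₁ : X.Opens := ⟨{x | ∃ hx : x ∈ W, X.presheaf.germ W x hx s ≠ 0}, by
    rw [isOpen_iff_forall_mem_open]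
    rintro x ⟨hx, h⟩
    obtain ⟨U, hxU, hUW, hU⟩ := hopen x hx
    exact ⟨U, fun y hy => ⟨hUW hy, fun h0 => h ((hU y hy _).1 h0)⟩, U.isOpen, hxU⟩⟩
  let W₀ : X.Opens := ⟨{x | ∃ hx : x ∈ W, X.presheaf.germ W x hx s = 0}, by
    rw [isOpen_iff_forall_mem_open]
    rintro x ⟨hx, h⟩
    obtain ⟨U, hxU, hUW, hU⟩ := hopen x hx
    exact ⟨U, fun y hy => ⟨hUW hy, (hU y hy _).2 h⟩, U.isOpen, hxU⟩⟩
  obtain ⟨e, h1, h0⟩ := Scheme.exists_germ_eq_one_and_germ_eq_zero (W := W) (W₁ := W₁) (W₀ := W₀)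
    (fun x hx => hx.1) (fun x hx => hx.1)
    (by
      rw [disjoint_iff_inf_le]
      rintro x ⟨⟨_, h⟩, ⟨_, h'⟩⟩
      exact h h')
    (by
      intro x hx
      by_cases h : X.presheaf.germ W x hx s = 0
      · exact Or.inr ⟨hx, h⟩
      · exact Or.inl ⟨hx, h⟩)
  exact ⟨e, fun x hx => ⟨fun h => h1 x ⟨hx, h⟩, fun h => h0 x ⟨hx, h⟩⟩⟩

namespace IsFlatQuotient

variable {a p : Z ⟶ X} {φ : X ⟶ Y}

/-- A quotient of two invariant functions that is regular on `X` is invariant. -/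
theorem dvd_of_app_dvd [IsLocallyKrull X] (hφ : IsFlatQuotient a p φ) {V : Y.Opens} {t s : Γ(Y, V)}
    (ht : ∀ x (hx : x ∈ φ ⁻¹ᵁ V), X.presheaf.germ _ x hx (φ.app V t) ≠ 0)
    (h : φ.app V t ∣ φ.app V s) : t ∣ s := by
  obtain ⟨b, hb⟩ := h
  have := hφ.flat_right
  obtain ⟨c, rfl⟩ := (hφ.exists_app_eq_iff V b).2 (by
    intro z ha hp
    have := isDomain_stalk_of_isLocallyKrull (p z)
    refine Flat.stalkMap_mul_left_cancel p (ht (p z) hp) ?_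
    have h1 := (hφ.exists_app_eq_iff V (φ.app V t)).1 ⟨t, rfl⟩ z ha hp
    have h2 := (hφ.exists_app_eq_iff V (φ.app V s)).1 ⟨s, rfl⟩ z ha hp
    rw [hb, map_mul, map_mul, map_mul, map_mul, h1] at h2
    exact h2)
  exact ⟨c, hφ.app_injective V (by rw [hb, map_mul])⟩

/-- The locus where an invariant function has nonzero germ is open, closed and invariant, by
injectivity of flat maps of local rings, so its indicator function is a function on the quotient. -/
theorem exists_germ_indicator [IsLocallyKrull X] (hφ : IsFlatQuotient a p φ) {V : Y.Opens}
    (s : Γ(Y, V)) :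
    ∃ c : Γ(Y, V), ∀ x (hx : x ∈ φ ⁻¹ᵁ V),
      (X.presheaf.germ _ x hx (φ.app V s) ≠ 0 → X.presheaf.germ _ x hx (φ.app V c) = 1) ∧
      (X.presheaf.germ _ x hx (φ.app V s) = 0 → X.presheaf.germ _ x hx (φ.app V c) = 0) := by
  obtain ⟨e, he⟩ := Scheme.exists_germ_indicator (φ.app V s)
  have := hφ.flat_right
  have := hφ.flat_left
  obtain ⟨c, rfl⟩ := (hφ.exists_app_eq_iff V e).2 (by
    intro z ha hp
    have h1 := (hφ.exists_app_eq_iff V (φ.app V s)).1 ⟨s, rfl⟩ z ha hp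
    by_cases h : X.presheaf.germ _ _ hp (φ.app V s) = 0
    · rw [h, map_zero, map_eq_zero_iff _ (Flat.stalkMap_injective a z)] at h1
      rw [(he _ ha).2 h1, (he _ hp).2 h, map_zero, map_zero]
    · have h' : X.presheaf.germ _ _ ha (φ.app V s) ≠ 0 := by
        intro h0
        rw [h0, map_zero, eq_comm, map_eq_zero_iff _ (Flat.stalkMap_injective p z)] at h1
        exact h h1
      rw [(he _ ha).1 h', (he _ hp).1 h, map_one, map_one])
  exact ⟨c, he⟩

end IsFlatQuotient

/-- Every nonzero function on the open subset `V` of `Y` pulls back along `φ` to a function all of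
whose germs are nonzero. When the local rings of `X` are domains, this means that `Γ(Y, V)` embeds
into each local ring of `φ⁻¹(V)`, whichever component of `X` the point lies on. -/
def HasNonzeroGerms (φ : X ⟶ Y) (V : Y.Opens) : Prop :=
  ∀ s : Γ(Y, V), s ≠ 0 → ∀ x (hx : x ∈ φ ⁻¹ᵁ V), X.presheaf.germ _ x hx (φ.app V s) ≠ 0

namespace IsFlatQuotient

variable {a p : Z ⟶ X} {φ : X ⟶ Y}

/-- Each point of the quotient has an affine neighbourhood `V` such that nonzero functions on `V`
have nonzero germs on `X`. It suffices to choose `V` such that `φ⁻¹(V)` meets as few members as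
possible of a finite cover of `X` by spectra of domains: the indicator function of a proper
nonempty vanishing locus would cut out a smaller neighbourhood. -/
theorem exists_hasNonzeroGerms [CompactSpace X] [IsLocallyKrull X] (hφ : IsFlatQuotient a p φ)
    (y : Y) : ∃ V : Y.Opens, y ∈ V ∧ IsAffineOpen V ∧ HasNonzeroGerms φ V := by
  classical
  obtain ⟨T, hT, hcov⟩ := exists_finset_affine_isDomain_cover X
  let N (V : Y.Opens) : Finset X.Opens := {U ∈ T | ∃ x ∈ U, x ∈ φ ⁻¹ᵁ V}
  have hN : ∀ V U, U ∈ N V ↔ U ∈ T ∧ ∃ x ∈ U, x ∈ φ ⁻¹ᵁ V := fun V U => Finset.mem_filter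
  let P : Set Y.Opens := {V | y ∈ V ∧ IsAffineOpen V}
  have hP : P.Nonempty := by
    obtain ⟨V, hV, hy, -⟩ := exists_isAffineOpen_mem_and_subset (x := y) (U := ⊤) trivial
    exact ⟨V, hy, hV⟩
  let V := Function.argminOn N P hP
  obtain ⟨hyV, hV⟩ : V ∈ P := Function.argminOn_mem N P hP
  have hmin : ∀ V' ∈ P, ¬ N V' < N V := fun V' hV' => Function.not_lt_argminOn N P hV'
  refine ⟨V, hyV, hV, fun s hs x hx hx0 => ?_⟩
  obtain ⟨c, hc⟩ := hφ.exists_germ_indicator s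
  -- neither `D(c)` nor `D(1 - c)` may meet fewer members of the cover than `V`
  have key : ∀ c' : Γ(Y, V), ∀ x (hx : x ∈ φ ⁻¹ᵁ V),
      (∀ U ∈ T, x ∈ U → ∀ w (hw : w ∈ φ ⁻¹ᵁ V), w ∈ U →
        X.presheaf.germ _ w hw (φ.app V c') = 0) → y ∉ Y.basicOpen c' := by
    intro c' x hx h hy
    refine hmin (Y.basicOpen c') ⟨hy, hV.basicOpen c'⟩ (Finset.ssubset_iff_subset_ne.2 ⟨?_, ?_⟩)
    · intro U hU
      rw [hN] at hU ⊢
      obtain ⟨hUT, w, hwU, hw⟩ := hU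
      exact ⟨hUT, w, hwU, Y.basicOpen_le c' hw⟩
    · intro heq
      obtain ⟨U, hUT, hxU⟩ := hcov x
      have hU : U ∈ N V := (hN _ _).2 ⟨hUT, x, hxU, hx⟩
      rw [← heq, hN] at hU
      obtain ⟨-, w, hwU, hw⟩ := hU
      have hwV : w ∈ φ ⁻¹ᵁ V := Y.basicOpen_le c' hw
      rw [Scheme.preimage_basicOpen, X.mem_basicOpen _ _ hwV, h U hUT hxU w hwV hwU] at hw
      have := isDomain_stalk_of_isLocallyKrull w
      exact not_isUnit_zero hw
  have hloc : ∀ U ∈ T, ∀ v w, v ∈ U → w ∈ U → ∀ (hv : v ∈ φ ⁻¹ᵁ V) (hw : w ∈ φ ⁻¹ᵁ V),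
      X.presheaf.germ _ v hv (φ.app V s) = 0 → X.presheaf.germ _ w hw (φ.app V s) = 0 := by
    intro U hU v w hv hw hvV hwV h
    obtain ⟨hUa, hUd⟩ := hT U hU
    exact hUa.germ_eq_zero_of_germ_eq_zero hv hvV hw hwV h
  obtain ⟨v, hv, hv0⟩ : ∃ v, ∃ hv : v ∈ φ ⁻¹ᵁ V, X.presheaf.germ _ v hv (φ.app V s) ≠ 0 := by
    by_contra! hcon
    exact hs (hφ.app_injective V (Scheme.section_ext_germ fun w hw => by
      rw [hcon w hw, map_zero, map_zero]))
  rcases IsLocalRing.isUnit_or_isUnit_one_sub_self (Y.presheaf.germ V y hyV c) with h | h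
  · exact key c x hx (fun U hU hxU w hw hwU => (hc w hw).2 (hloc U hU x w hxU hwU hx hw hx0))
      ((Y.mem_basicOpen _ _ hyV).2 h)
  · refine key (1 - c) v hv (fun U hU hvU w hw hwU => ?_)
      ((Y.mem_basicOpen _ _ hyV).2 (by rwa [map_sub, map_one]))
    rw [map_sub, map_one, map_sub, map_one,
      (hc w hw).1 (fun h0 => hv0 (hloc U hU w v hwU hvU hw hv h0)), sub_self]

end IsFlatQuotient

end AlgebraicGeometry

/-! ### The quotient of a locally Krull scheme -/

namespace AlgebraicGeometry

variable {X Y Z : Scheme.{u}}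

theorem eq_of_specializes_of_mem_irreducibleComponents {T : Type*} [TopologicalSpace T] [T0Space T]
    {C : Set T} (hC : C ∈ irreducibleComponents T) {z w : T} (hz : IsGenericPoint z C)
    (h : w ⤳ z) : w = z := by
  have h1 : C ⊆ closure {w} := by
    rw [← hz.def]
    exact h.closure_subset
  have h2 := hC.le_of_ge (isIrreducible_singleton (x := w)).closure h1
  exact (h.antisymm (hz.specializes (h2 (subset_closure rfl)))).eq

theorem exists_isGenericPoint_of_mem_irreducibleComponents {C : Set X}
    (hC : C ∈ irreducibleComponents X) : ∃ z, IsGenericPoint z C :=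
  QuasiSober.sober hC.prop (isClosed_of_mem_irreducibleComponents C hC)

/-- The local ring at a generic point of a component is a field as soon as it is a domain. -/
theorem Scheme.isUnit_of_ne_zero_of_isGenericPoint {C : Set X} (hC : C ∈ irreducibleComponents X)
    {z : X} (hz : IsGenericPoint z C) [IsDomain (X.presheaf.stalk z)] {f : X.presheaf.stalk z}
    (hf : f ≠ 0) : IsUnit f := by
  have h1 : X.fromSpecStalk z (⊥ : PrimeSpectrum _) ⤳ z := by
    have : X.fromSpecStalk z (⊥ : PrimeSpectrum _) ∈ Set.range (X.fromSpecStalk z) := ⟨_, rfl⟩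
    rwa [Scheme.range_fromSpecStalk] at this
  have h2 := eq_of_specializes_of_mem_irreducibleComponents hC hz h1
  have h3 : (⊥ : PrimeSpectrum (X.presheaf.stalk z)) = IsLocalRing.closedPoint _ :=
    (X.fromSpecStalk z).isEmbedding.injective (h2.trans Scheme.fromSpecStalk_closedPoint.symm)
  by_contra hu
  have h4 : f ∈ (IsLocalRing.closedPoint (X.presheaf.stalk z)).asIdeal := hu
  rw [← h3] at h4
  exact hf h4

theorem finite_irreducibleComponents_of_isLocallyKrull (X : Scheme.{u}) [CompactSpace X]
    [IsLocallyKrull X] : (irreducibleComponents X).Finite := by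
  obtain ⟨T, hT, hcov⟩ := exists_finset_affine_isDomain_cover X
  refine (T.finite_toSet.image fun U : X.Opens => closure (U : Set X)).subset fun C hC => ?_
  obtain ⟨z, hz⟩ := exists_isGenericPoint_of_mem_irreducibleComponents hC
  obtain ⟨U, hU, hzU⟩ := hcov z
  obtain ⟨hUa, hUd⟩ := hT U hU
  have hirr : IsIrreducible (U : Set X) := by
    rw [← hUa.range_fromSpec, ← Set.image_univ]
    exact (IrreducibleSpace.isIrreducible_univ (PrimeSpectrum Γ(X, U))).image _
      hUa.fromSpec.continuous.continuousOn
  have hle : C ⊆ closure (U : Set X) := by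
    rw [← hz.def]
    exact closure_mono (Set.singleton_subset_iff.2 hzU)
  exact ⟨U, hU, (hC.eq_of_le hirr.closure hle).symm⟩

theorem IsAffineOpen.mem_primeIdealOf_iff {V : Y.Opens} (hV : IsAffineOpen V) {y : Y} (hy : y ∈ V)
    {f : Γ(Y, V)} : f ∈ (hV.primeIdealOf ⟨y, hy⟩).asIdeal ↔ y ∉ Y.basicOpen f := by
  let : Algebra Γ(Y, V) (Y.presheaf.stalk y) := (Y.presheaf.germ V y hy).hom.toAlgebra
  have : IsLocalization.AtPrime (Y.presheaf.stalk y) (hV.primeIdealOf ⟨y, hy⟩).asIdeal :=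
    hV.isLocalization_stalk ⟨y, hy⟩
  have h := IsLocalization.AtPrime.isUnit_to_map_iff (Y.presheaf.stalk y)
    (hV.primeIdealOf ⟨y, hy⟩).asIdeal f
  rw [Y.mem_basicOpen _ _ hy, ← not_iff_not, not_not]
  exact h.symm

theorem IsAffineOpen.specializes_of_forall_mem_basicOpen {V : Y.Opens} (hV : IsAffineOpen V)
    {y w : Y} (hw : w ∈ V)
    (h : ∀ f : Γ(Y, V), w ∈ Y.basicOpen f → y ∈ Y.basicOpen f) : y ⤳ w := by
  rw [specializes_iff_forall_open]
  intro O hO hwO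
  obtain ⟨f, hf, hwf⟩ := hV.exists_basicOpen_le (V := ⟨O, hO⟩) ⟨w, hwO⟩ hw
  exact hf (h f hwf)

namespace HasNonzeroGerms

variable {a p : Z ⟶ X} {φ : X ⟶ Y} {V : Y.Opens}

theorem nonempty_preimage (hφ : IsFlatQuotient a p φ) {y : Y} (hy : y ∈ V) :
    ∃ x, x ∈ φ ⁻¹ᵁ V := by
  by_contra! hcon
  have h : (1 : Γ(Y, V)) = 0 := hφ.app_injective V
    (Scheme.section_ext_germ fun x hx => (hcon x hx).elim)
  have h1 := congrArg (Y.presheaf.germ V y hy) h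
  rw [map_one, map_zero] at h1
  exact one_ne_zero h1

theorem isDomain [IsLocallyKrull X] (hV : HasNonzeroGerms φ V) (hφ : IsFlatQuotient a p φ)
    {y : Y} (hy : y ∈ V) : IsDomain Γ(Y, V) := by
  obtain ⟨x, hx⟩ := nonempty_preimage hφ hy
  have := isDomain_stalk_of_isLocallyKrull x
  let j : Γ(Y, V) →+* X.presheaf.stalk x := (X.presheaf.germ _ x hx).hom.comp (φ.app V).hom
  have hj : Function.Injective j := by
    rw [injective_iff_map_eq_zero]
    intro s hs
    by_contra h
    exact hV s h x hx hs
  exact hj.isDomain j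

theorem isKrullDomain [CompactSpace X] [IsLocallyKrull X] (hV : HasNonzeroGerms φ V)
    (hφ : IsFlatQuotient a p φ) {y : Y} (hy : y ∈ V) : IsKrullDomain Γ(Y, V) := by
  obtain ⟨F⟩ := nonempty_krullFamily X
  have := hV.isDomain hφ hy
  let j (l : {l : F.idx // F.pt l ∈ φ ⁻¹ᵁ V}) : Γ(Y, V) →+* F.ring l.1 :=
    (F.hom l.1).comp ((X.presheaf.germ _ _ l.2).hom.comp (φ.app V).hom)
  refine IsKrullDomain.of_discreteValuationRings
    (fun l : {l : F.idx // F.pt l ∈ φ ⁻¹ᵁ V} => F.ring l.1) j ?_ ?_ ?_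
  · intro l
    rw [injective_iff_map_eq_zero]
    intro s hs
    by_contra h
    exact hV s h _ l.2 ((map_eq_zero_iff _ (F.hom_injective l.1)).1 hs)
  · intro t s ht h
    exact hφ.dvd_of_app_dvd (hV t ht) (F.dvd_of_hom_dvd _ _ _ (hV t ht) fun l hl => h ⟨l, hl⟩)
  · intro t ht
    refine ((F.finite_notMem_basicOpen _ _ (hV t ht)).preimage
      Subtype.val_injective.injOn).subset ?_
    rintro ⟨l, hl⟩ h
    exact ⟨hl, fun h' => h (((X.mem_basicOpen _ _ hl).1 h').map (F.hom l))⟩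

/-- The generic points of the components of `X` that meet `φ⁻¹(V)` are mapped to the generic point
of `V`. -/
theorem specializes_of_isGenericPoint [IsLocallyKrull X] (hV : HasNonzeroGerms φ V)
    (hVa : IsAffineOpen V) {C : Set X} (hC : C ∈ irreducibleComponents X) {z : X}
    (hz : IsGenericPoint z C) (hzV : z ∈ φ ⁻¹ᵁ V) {y : Y} (hy : y ∈ V) : φ z ⤳ y := by
  refine hVa.specializes_of_forall_mem_basicOpen hy fun f hf => ?_
  have := isDomain_stalk_of_isLocallyKrull z
  have h := Scheme.isUnit_of_ne_zero_of_isGenericPoint hC hz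
    (hV f (by rintro rfl; simp at hf) z hzV)
  have h1 : z ∈ φ ⁻¹ᵁ Y.basicOpen f := by
    rw [Scheme.preimage_basicOpen]
    exact (X.mem_basicOpen _ _ hzV).2 h
  exact h1

theorem exists_isGenericPoint_specializes [IsLocallyKrull X] (hV : HasNonzeroGerms φ V)
    (hφ : IsFlatQuotient a p φ) (hVa : IsAffineOpen V) {y : Y} (hy : y ∈ V) :
    ∃ C ∈ irreducibleComponents X, ∃ z, IsGenericPoint z C ∧ z ∈ φ ⁻¹ᵁ V ∧ φ z ⤳ y := by
  obtain ⟨x, hx⟩ := nonempty_preimage hφ hy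
  have hC := irreducibleComponent_mem_irreducibleComponents x
  obtain ⟨z, hz⟩ := exists_isGenericPoint_of_mem_irreducibleComponents hC
  have hzV : z ∈ φ ⁻¹ᵁ V := (hz.specializes mem_irreducibleComponent).mem_open (φ ⁻¹ᵁ V).isOpen hx
  exact ⟨_, hC, z, hz, hzV, hV.specializes_of_isGenericPoint hVa hC hz hzV hy⟩

end HasNonzeroGerms

namespace IsFlatQuotient

variable {a p : Z ⟶ X} {φ : X ⟶ Y}

theorem isLocallyKrull [CompactSpace X] [IsLocallyKrull X] (hφ : IsFlatQuotient a p φ) :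
    IsLocallyKrull Y where
  exists_isAffineOpen y := by
    obtain ⟨V, hy, hVa, hV⟩ := hφ.exists_hasNonzeroGerms y
    exact ⟨V, hy, hVa, hV.isKrullDomain hφ hy⟩

theorem closure_image_mem_irreducibleComponents [CompactSpace X] [IsLocallyKrull X]
    (hφ : IsFlatQuotient a p φ) {C : Set X} (hC : C ∈ irreducibleComponents X) :
    closure (φ '' C) ∈ irreducibleComponents Y := by
  obtain ⟨z, hz⟩ := exists_isGenericPoint_of_mem_irreducibleComponents hC
  obtain ⟨V, hy, hVa, hV⟩ := hφ.exists_hasNonzeroGerms (φ z)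
  refine ⟨(hC.prop.image _ φ.continuous.continuousOn).closure, fun T hT hle => ?_⟩
  obtain ⟨t, ht⟩ := QuasiSober.sober hT.closure isClosed_closure
  have hzT : φ z ∈ closure T := subset_closure (hle (subset_closure ⟨z, hz.mem, rfl⟩))
  have htV : t ∈ V := (ht.specializes hzT).mem_open V.isOpen hy
  have h := hV.specializes_of_isGenericPoint hVa hC hz hy htV
  refine subset_closure.trans ?_
  rw [← ht.def, ← (hz.image φ.continuous).def]
  exact h.closure_subset

theorem finite_irreducibleComponents [CompactSpace X] [IsLocallyKrull X]
    (hφ : IsFlatQuotient a p φ) : (irreducibleComponents Y).Finite := by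
  refine ((finite_irreducibleComponents_of_isLocallyKrull X).image
    fun C => closure (φ '' C)).subset fun T hT => ?_
  obtain ⟨t, ht⟩ := exists_isGenericPoint_of_mem_irreducibleComponents hT
  obtain ⟨V, hy, hVa, hV⟩ := hφ.exists_hasNonzeroGerms t
  obtain ⟨C, hC, z, hz, -, hzt⟩ := hV.exists_isGenericPoint_specializes hφ hVa hy
  refine ⟨C, hC, (hT.eq_of_le (hφ.closure_image_mem_irreducibleComponents hC).prop ?_).symm⟩
  rw [← ht.def, ← (hz.image φ.continuous).def]
  exact hzt.closure_subset

/-- The points of codimension at most one of the quotient are in the image of `φ`. For a point `y`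
of codimension one and a nonzero function `f` vanishing at `y`, one of the finitely many members of
a defining family of `X` at which `f` is not a unit has its centre above `y`. Otherwise there are
functions on `Y` not vanishing at `y` but at all of these centres, and a product of large powers of
them is divisible by `f`. -/
theorem two_le_ringKrullDim_stalk [CompactSpace X] [IsLocallyKrull X] (hφ : IsFlatQuotient a p φ)
    {y : Y} (hy : y ∉ Set.range φ) : 2 ≤ ringKrullDim (Y.presheaf.stalk y) := by
  obtain ⟨V, hyV, hVa, hV⟩ := hφ.exists_hasNonzeroGerms y
  have := hV.isDomain hφ hyV
  let P (w : Y) (hw : w ∈ V) := (hVa.primeIdealOf ⟨w, hw⟩).asIdeal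
  have hP : ∀ w hw f, f ∈ P w hw ↔ w ∉ Y.basicOpen f := fun w hw f => hVa.mem_primeIdealOf_iff hw
  by_contra hdim
  have hheight : (P y hyV).height < 2 := by
    let : Algebra Γ(Y, V) (Y.presheaf.stalk y) := (Y.presheaf.germ V y hyV).hom.toAlgebra
    have : IsLocalization.AtPrime (Y.presheaf.stalk y) (P y hyV) :=
      hVa.isLocalization_stalk ⟨y, hyV⟩
    rw [IsLocalization.AtPrime.ringKrullDim_eq_height (P y hyV), not_le] at hdim
    exact WithBot.coe_lt_coe.1 hdim
  obtain ⟨f, hf0, hfy⟩ : ∃ f : Γ(Y, V), f ≠ 0 ∧ y ∉ Y.basicOpen f := by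
    -- otherwise `y` is the generic point of `V`, which is in the image
    by_contra! hcon
    obtain ⟨C, hC, z, hz, hzV, hzy⟩ := hV.exists_isGenericPoint_specializes hφ hVa hyV
    refine hy ⟨z, (hzy.antisymm (hVa.specializes_of_forall_mem_basicOpen hzV fun f hf => ?_)).eq⟩
    exact hcon f (by rintro rfl; simp at hf)
  obtain ⟨F⟩ := nonempty_krullFamily X
  have hfin := F.finite_notMem_basicOpen _ _ (hV f hf0)
  have key : ∀ l (hl : F.pt l ∈ φ ⁻¹ᵁ V), F.pt l ∉ X.basicOpen (φ.app V f) →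
      ∃ g : Γ(Y, V), y ∈ Y.basicOpen g ∧
        F.hom l (X.presheaf.germ _ _ hl (φ.app V f)) ∣
          F.hom l (X.presheaf.germ _ _ hl (φ.app V g)) := by
    intro l hl hlf
    have hmem : ∀ g, g ∈ P (φ (F.pt l)) hl ↔ F.pt l ∉ X.basicOpen (φ.app V g) := by
      intro g
      rw [← Scheme.preimage_basicOpen]
      exact hP _ hl g
    have hnle : ¬ P (φ (F.pt l)) hl ≤ P y hyV := by
      intro hle
      have hne : P (φ (F.pt l)) hl ≠ P y hyV := by
        intro heq
        have h1 : hVa.primeIdealOf ⟨φ (F.pt l), hl⟩ = hVa.primeIdealOf ⟨y, hyV⟩ :=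
          PrimeSpectrum.ext heq
        have h2 := congrArg hVa.fromSpec h1
        rw [hVa.fromSpec_primeIdealOf, hVa.fromSpec_primeIdealOf] at h2
        exact hy ⟨_, h2⟩
      -- the chain `0 < P (φ (F.pt l)) < P y` contradicts the bound on the height
      have hbot : (⊥ : Ideal Γ(Y, V)) < P (φ (F.pt l)) hl :=
        bot_lt_iff_ne_bot.2 fun h => hf0 (by
          have := (hmem f).2 hlf
          rwa [h] at this)
      have h1 := Ideal.height_add_one_le_of_lt_of_isPrime hbot
      have h2 := Ideal.height_add_one_le_of_lt_of_isPrime (lt_of_le_of_ne hle hne)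
      refine hheight.not_ge (le_trans ?_ h2)
      rw [← one_add_one_eq_two]
      gcongr
      exact le_trans le_add_self h1
    obtain ⟨g, hg, hgy⟩ := SetLike.not_le_iff_exists.1 hnle
    rw [hP, not_not] at hgy
    rw [hmem, X.mem_basicOpen _ _ hl] at hg
    obtain ⟨n, hn⟩ := IsDiscreteValuationRing.exists_dvd_pow
      (q := F.hom l (X.presheaf.germ _ _ hl (φ.app V f)))
      (a := F.hom l (X.presheaf.germ _ _ hl (φ.app V g)))
      (fun h => hV f hf0 _ hl ((map_eq_zero_iff _ (F.hom_injective l)).1 h))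
      (fun h => hg ((F.isLocalHom_hom l).map_nonunit _ h))
    refine ⟨g ^ n, ?_, by simpa only [map_pow] using hn⟩
    rw [Y.mem_basicOpen _ _ hyV] at hgy ⊢
    rw [map_pow]
    exact hgy.pow n
  choose! g hgy hg using key
  have hdvd : f ∣ ∏ l ∈ hfin.toFinset, g l := by
    refine hφ.dvd_of_app_dvd (hV f hf0) (F.dvd_of_hom_dvd _ _ _ (hV f hf0) fun l hl => ?_)
    by_cases h : F.pt l ∈ X.basicOpen (φ.app V f)
    · exact (((X.mem_basicOpen _ _ hl).1 h).map (F.hom l)).dvd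
    · refine (hg l hl h).trans (map_dvd _ (map_dvd _ (map_dvd _ (Finset.dvd_prod_of_mem g ?_))))
      exact hfin.mem_toFinset.2 ⟨hl, h⟩
  refine hfy ((Y.mem_basicOpen _ _ hyV).2 (isUnit_of_dvd_unit (map_dvd _ hdvd) ?_))
  rw [map_prod]
  refine IsUnit.prod_iff.2 fun l hl => ?_
  have hl' := hfin.mem_toFinset.1 hl
  exact (Y.mem_basicOpen _ _ hyV).1 (hgy l hl'.1 hl'.2)

theorem exists_isCompact_two_le_schemeCodim [CompactSpace X] [IsLocallyKrull X]
    (hφ : IsFlatQuotient a p φ) :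
    ∃ U : Y.Opens, IsCompact (U : Set Y) ∧ 2 ≤ schemeCodim Y (U : Set Y)ᶜ := by
  obtain ⟨U, hUc, hUo, hU, -⟩ := PrespectralSpace.exists_isCompact_and_isOpen_between
    (isCompact_range φ.continuous) isOpen_univ (Set.subset_univ _)
  exact ⟨⟨U, hUo⟩, hUc, le_iInf₂ fun y hy =>
    hφ.two_le_ringKrullDim_stalk fun h => hy (hU h)⟩

end IsFlatQuotient

end AlgebraicGeometry

theorem mainTheorem4 {S : Scheme.{u}} (G : Over S) [GrpObj G] [Flat G.hom]
    (X : Over S) [ModObj G X] [CompactSpace X.left] [QuasiSeparatedSpace X.left]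
    [IsLocallyKrull X.left] (Y : Over S) (φ : X ⟶ Y) (hφ : IsGInvariant G φ)
    (hiso : ∀ V : Y.left.Opens, Function.Bijective (toPushforwardInvariants hφ V)) :
    IsLocallyKrull Y.left ∧
    (∀ Z ∈ irreducibleComponents X.left,
      closure (φ.left '' Z) ∈ irreducibleComponents Y.left) ∧
    (irreducibleComponents Y.left).Finite ∧
    ∃ U : Y.left.Opens, IsCompact (U : Set Y.left) ∧
      2 ≤ schemeCodim Y.left (U : Set Y.left)ᶜ := by
  have hq := hφ.isFlatQuotient hiso
  exact ⟨hq.isLocallyKrull, fun _ hC => hq.closure_image_mem_irreducibleComponents hC,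
    hq.finite_irreducibleComponents, hq.exists_isCompact_two_le_schemeCodim⟩
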